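/- Let $A$ and $B$ be quantum systems. For a density matrix $\rho$ of $AB$ let $\rho^{R_A}=\mathbb I_A\otimes\mathrm{Tr}_A(\rho)-\rho$ denote its image under the partial reduction map, and let $$H_R=\mathbb I_A\otimes S_B-S_{AB},$$ where $\mathbb I_A$ is the identity on two copies of $A$, $S_B$ is the swap of two copies of $B$, and $S_{AB}$ is the swap of two copies of $AB$. (i) $H_R$ is the Hamiltonian that implements the partial reduction map: $H_R=\Lambda^{T_1}$, where $\Lambda=\sum_{i,j}|i\rangle\langle j|\otimes(|i\rangle\langle j|)^{R_A}$ is the Choi matrix of the map $\rho\mapsto\rho^{R_A}$ and $T_1$ is the partial transposition on the first factor. (ii) Let $d_A=d_B=\sqrt d$. An unknown pure state $\rho$ of $AB$ is drawn as follows: with probability $\tfrac12$ it is a product $\psi_A\otimes\psi_B$ of two independent local Haar-random pure states, and with probability $\tfrac12$ it is a global Haar-random pure state $\psi_{AB}$. Consider the following circuit, with total evolution time $t=\pi$ and $K$ steps. An ancilla qubit is prepared in $|0\rangle$ and a memory system in $\rho$; a Hadamard gate is applied to the ancilla; then, $K$ times, a fresh copy of $\rho$ is prepared, the unitary $e^{-i(|1\rangle\langle1|\otimes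 H_R)\pi/K}$ is applied to the ancilla, the fresh copy and the memory ($H_R$ acting on the fresh copy and the memory), and the fresh copy is discarded; finally a Hadamard gate is applied to the ancilla, which is measured in the computational basis. The circuit uses $K+1$ copies of $\rho$. The outcome $0$ is read as "product state", and the outcome $1$ as "global random state". Then $\mathcal O(1)$ copies of $\rho$ suffice: there are constants $C$ and $d_0$ such that for all $d\ge d_0$ and all $K$ with $K+1\ge C$, a single run of this circuit identifies the class of $\rho$ correctly with probability at least $2/3$ (the probability being over the choice of $\rho$ and the measurement). -/

import Mathlib

open scoped Matrix Kronecker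

noncomputable section

/-- The rank-one density matrix `|ψ⟩⟨ψ|`. -/
def pureDensity {ι : Type*} [Fintype ι] (ψ : EuclideanSpace ℂ ι) : Matrix ι ι ℂ :=
  Matrix.of fun i j => ψ i * star (ψ j)

/-- The law of a Haar-random pure state vector with basis labels `ι`: the normalized
(hence unitarily invariant) surface measure on the unit sphere of `ℂ^ι`. -/
def haarState (ι : Type*) [Fintype ι] :
    MeasureTheory.Measure (Metric.sphere (0 : EuclideanSpace ℂ ι) 1) :=
  ((MeasureTheory.volume : MeasureTheory.Measure (EuclideanSpace ℂ ι)).toSphere Set.univ)⁻¹ •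
    (MeasureTheory.volume : MeasureTheory.Measure (EuclideanSpace ℂ ι)).toSphere

/-- Partial trace over the first tensor factor. -/
def trFirst {h k : Type*} [Fintype h] (M : Matrix (h × k) (h × k) ℂ) : Matrix k k ℂ :=
  Matrix.of fun y y' => ∑ x, M (x, y) (x, y')

/-- The operator `e^{-iHt}`. -/
def evolution {ι : Type*} [Fintype ι] [DecidableEq ι] (H : Matrix ι ι ℂ) (t : ℝ) :
    Matrix ι ι ℂ :=
  NormedSpace.exp ((-Complex.I * (t : ℂ)) • H)

/-- The swap operator on two copies of a system. -/
def swapOp (D : Type*) [DecidableEq D] : Matrix (D × D) (D × D) ℂ :=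
  Matrix.of fun p q => if p = q.swap then 1 else 0

/-- `H_R = 𝕀_A ⊗ S_B - S_{AB}` on two copies of the bipartite system `AB`. The first summand is
`𝕀_A ⊗ S_B` on `(AA)(BB)`, with the tensor factors reordered to `(AB)(AB)`. -/
def reductionHamiltonian (A B : Type*) [DecidableEq A] [DecidableEq B] :
    Matrix ((A × B) × (A × B)) ((A × B) × (A × B)) ℂ :=
  Matrix.reindex (Equiv.prodProdProdComm A A B B) (Equiv.prodProdProdComm A A B B)
    ((1 : Matrix (A × A) (A × A) ℂ) ⊗ₖ swapOp B) - swapOp (A × B)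

/-- The partial reduction map `ρ ↦ 𝕀_A ⊗ Tr_A ρ - ρ`. -/
def partialReduction (A B : Type*) [Fintype A] [DecidableEq A] :
    Matrix (A × B) (A × B) ℂ →ₗ[ℂ] Matrix (A × B) (A × B) ℂ where
  toFun ρ := (1 : Matrix A A ℂ) ⊗ₖ trFirst ρ - ρ
  map_add' ρ σ := by
    ext i j
    simp [trFirst, Finset.sum_add_distrib, mul_add]
    ring
  map_smul' c ρ := by
    ext i j
    simp [trFirst, ← Finset.mul_sum]
    ring

/-- The Choi matrix `(ℐ ⊗ 𝒩)(|Φ⁺⟩⟨Φ⁺|)`, where `|Φ⁺⟩ = ∑ i, |ii⟩`. -/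
def choiMatrix {h k : Type*} [DecidableEq h]
    (N : Matrix h h ℂ →ₗ[ℂ] Matrix k k ℂ) : Matrix (h × k) (h × k) ℂ :=
  Matrix.of fun p q => N (Matrix.single p.1 q.1 1) p.2 q.2

/-- Partial transposition on the first tensor factor. -/
def transposeFirst {h k : Type*} (M : Matrix (h × k) (h × k) ℂ) : Matrix (h × k) (h × k) ℂ :=
  Matrix.of fun p q => M (q.1, p.2) (p.1, q.2)

/-- The HME Hamiltonian that implements a Hermitian-preserving map: the partial transpose, on the
first system, of its Choi matrix. -/
def hmeHamiltonian {h k : Type*} [DecidableEq h]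
    (N : Matrix h h ℂ →ₗ[ℂ] Matrix k k ℂ) : Matrix (h × k) (h × k) ℂ :=
  transposeFirst (choiMatrix N)

/-- One step of Hermitian-preserving map exponentiation: prepare a fresh copy of `ρ` on the first
system, evolve it jointly with the memory under `e^{-iHt}`, and discard the first system. -/
def hmeStep {h k : Type*} [Fintype h] [Fintype k] [DecidableEq h] [DecidableEq k]
    (H : Matrix (h × k) (h × k) ℂ) (t : ℝ) (ρ : Matrix h h ℂ) (σ : Matrix k k ℂ) :
    Matrix k k ℂ :=
  trFirst (evolution H t * (ρ ⊗ₖ σ) * (evolution H t)ᴴ)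

/-- The controlled Hamiltonian `|1⟩⟨1|_c ⊗ H`; the control qubit `c` is grouped with the memory,
so that the tensor factors are (fresh copy) ⊗ ((control qubit) ⊗ (memory)). -/
def controlledHamiltonian {h k : Type*} (H : Matrix (h × k) (h × k) ℂ) :
    Matrix (h × (Fin 2 × k)) (h × (Fin 2 × k)) ℂ :=
  Matrix.of fun p q =>
    (Matrix.single 1 1 1 : Matrix (Fin 2) (Fin 2) ℂ) p.2.1 q.2.1 *
      H (p.1, p.2.2) (q.1, q.2.2)

/-- The Hadamard gate. -/
def hadamardGate : Matrix (Fin 2) (Fin 2) ℂ :=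
  ((Real.sqrt 2 : ℂ)⁻¹) • !![1, 1; 1, -1]

/-- The Hadamard gate acting on the ancilla qubit, as a channel. -/
def hadamardOnAncilla {k : Type*} [Fintype k] [DecidableEq k]
    (τ : Matrix (Fin 2 × k) (Fin 2 × k) ℂ) : Matrix (Fin 2 × k) (Fin 2 × k) ℂ :=
  (hadamardGate ⊗ₖ (1 : Matrix k k ℂ)) * τ * (hadamardGate ⊗ₖ (1 : Matrix k k ℂ))ᴴ

/-- The final state of the one-ancilla circuit with Hamiltonian `H`, total time `t` and `K` HME
steps, run on copies of `ρ`. The ancilla starts in `|0⟩` and the memory in `ρ`; then come a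
Hadamard gate on the ancilla, `K` controlled HME steps of duration `t / K`, each of which consumes
a fresh copy of `ρ`, and another Hadamard gate on the ancilla. In total `K + 1` copies of `ρ` are
used. -/
def circuitOutput {k : Type*} [Fintype k] [DecidableEq k]
    (H : Matrix (k × k) (k × k) ℂ) (t : ℝ) (K : ℕ) (ρ : Matrix k k ℂ) :
    Matrix (Fin 2 × k) (Fin 2 × k) ℂ :=
  hadamardOnAncilla
    ((hmeStep (controlledHamiltonian H) (t / K) ρ)^[K]
      (hadamardOnAncilla ((Matrix.single 0 0 1 : Matrix (Fin 2) (Fin 2) ℂ) ⊗ₖ ρ)))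

/-- The probability that measuring the ancilla of the circuit in the computational basis gives
the outcome `b`. -/
def outcomeProb {k : Type*} [Fintype k] [DecidableEq k]
    (H : Matrix (k × k) (k × k) ℂ) (t : ℝ) (K : ℕ) (ρ : Matrix k k ℂ) (b : Fin 2) : ℝ :=
  (((Matrix.single b b 1 : Matrix (Fin 2) (Fin 2) ℂ) ⊗ₖ (1 : Matrix k k ℂ)) *
    circuitOutput H t K ρ).trace.re

/-- The probability of success of a single run of the circuit with `H_R`, time `t = π` and `K` HME
steps, in local dimensions `d_A = d_B = n`. With probability `1/2` each, the unknown state is a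
product of two independent local Haar-random pure states (the correct outcome is then `0`) or a
global Haar-random pure state (the correct outcome is then `1`). -/
def successProb (n K : ℕ) : ℝ :=
  (1 / 2) * (∫ ψ, outcomeProb (reductionHamiltonian (Fin n) (Fin n)) Real.pi K
      (pureDensity (ψ.1 : EuclideanSpace ℂ (Fin n)) ⊗ₖ
        pureDensity (ψ.2 : EuclideanSpace ℂ (Fin n))) 0
      ∂((haarState (Fin n)).prod (haarState (Fin n)))) +
  (1 / 2) * (∫ ψ, outcomeProb (reductionHamiltonian (Fin n) (Fin n)) Real.pi K
      (pureDensity (ψ : EuclideanSpace ℂ (Fin n × Fin n))) 1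
      ∂(haarState (Fin n × Fin n)))

end

/-!
The two terms of `H_R` are permutation matrices, and `H_R = (1 - S_A) S_B` with commuting
involutions `S_A`, `S_B`. Part (i) is a comparison of matrix entries. For part (ii), `H_R³ = 4 H_R`
makes `e^{-i H_R t}` a quadratic polynomial in `H_R` (`evolution_of_cube`), and likewise for the
controlled Hamiltonian, which has the same property.

A step of the circuit multiplies the coherence `⟨1| τ |0⟩` of the ancilla from the left by
`L = Tr₁ [e^{-i H_R t} (ρ ⊗ 1)]`, and it preserves trace and Hermiticity, so the outcome `b` has
probability `1/2 + (-1)^b Re Tr (L^K ρ) / 2` (`outcomeProb_eq`). With `c = cos t`, `s = sin t`,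
`L = c² + s² ρ_A ⊗ 1 + i s c (ρ - 1 ⊗ ρ_B)` (`memoryOp_evolution`).

For a product of pure states `L ρ = ρ`, and the outcome is always `0` (`outcomeProb_product`). For a
pure state `ψ` with coefficient matrix `M`, both `(ρ_A ⊗ 1) ψ` and `(1 ⊗ ρ_B) ψ` have the
coefficient matrix `M Mᴴ M`, so that `L ψ = e^{it} c ψ - i s e^{it} M Mᴴ M`, where the error term
has norm at most `|s|` times the square root of the purity of `ρ_A`. As `L` is a compression of a
unitary, the errors of the `K` steps add up to at most `K |sin (π / K)| √purity ≤ π √purity`, while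
the main term is `(e^{iπ/K} cos (π / K))^K = - cos (π / K)^K ≤ 0` for `K ≥ 2`
(`re_trace_memoryOp_pow_le`). The probability of the outcome `1` is thus at least `1/2` up to
`(π / 2) √purity`.

The average purity of a Haar-random state tends to zero with the dimension (`integral_purity_le`).
It is computed from the invariance of the Haar measure under Householder reflections: these kill
the terms with four distinct coordinates, and bound the second moments `𝔼 |ψ_i|² |ψ_j|²`
(`haarMoment_le`). For large dimension the outcome `1` therefore has average probability at least
`1/3` on global random states, and the success probability is at least `1/2 + 1/6 = 2/3`.
-/

/-! ### Haar-random state vectors -/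

noncomputable section Haar

open MeasureTheory Metric
open scoped Pointwise

/-- An additive Haar measure on a normed space is invariant under linear isometries: the image
measure is a multiple of the original one, and both give the unit ball the same mass. -/
theorem LinearIsometryEquiv.measurePreserving_addHaar {E : Type*} [NormedAddCommGroup E]
    [NormedSpace ℝ E] [MeasurableSpace E] [BorelSpace E] [FiniteDimensional ℝ E]
    (μ : Measure E) [μ.IsAddHaarMeasure] (f : E ≃ₗᵢ[ℝ] E) : MeasurePreserving f μ μ := by
  refine ⟨f.continuous.measurable, ?_⟩
  have hdet : LinearMap.det (f.toLinearEquiv : E →ₗ[ℝ] E) ≠ 0 :=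
    (LinearEquiv.isUnit_det' f.toLinearEquiv).ne_zero
  have hmap := Measure.map_linearMap_addHaar_eq_smul_addHaar μ hdet
  have hf : ⇑(f.toLinearEquiv : E →ₗ[ℝ] E) = ⇑f := rfl
  rw [hf] at hmap
  have hball := congrArg (fun ν : Measure E => ν (ball 0 1)) hmap
  simp only [Measure.smul_apply, smul_eq_mul] at hball
  rw [Measure.map_apply f.continuous.measurable measurableSet_ball, f.preimage_ball,
    map_zero] at hball
  have h0 : μ (ball (0 : E) 1) ≠ 0 := (measure_ball_pos μ 0 one_pos).ne'
  have h1 : μ (ball (0 : E) 1) ≠ ⊤ := measure_ball_lt_top.ne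
  have hc : ENNReal.ofReal |(LinearMap.det (f.toLinearEquiv : E →ₗ[ℝ] E))⁻¹| = 1 :=
    ((ENNReal.mul_eq_right h0 h1).1 hball.symm)
  rw [hmap, hc, one_smul]

/-- The action of a linear isometry on the unit sphere. -/
def LinearIsometryEquiv.onSphere {E : Type*} [NormedAddCommGroup E] [NormedSpace ℝ E]
    (f : E ≃ₗᵢ[ℝ] E) (x : sphere (0 : E) 1) : sphere (0 : E) 1 :=
  ⟨f x, by simp⟩

theorem LinearIsometryEquiv.measurePreserving_onSphere {E : Type*} [NormedAddCommGroup E]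
    [NormedSpace ℝ E] [MeasurableSpace E] [BorelSpace E] [FiniteDimensional ℝ E]
    (μ : Measure E) [μ.IsAddHaarMeasure] (f : E ≃ₗᵢ[ℝ] E) :
    MeasurePreserving f.onSphere μ.toSphere μ.toSphere := by
  have hcont : Continuous f.onSphere :=
    (f.continuous.comp continuous_subtype_val).subtype_mk _
  refine ⟨hcont.measurable, Measure.ext fun s hs => ?_⟩
  rw [Measure.map_apply hcont.measurable hs, Measure.toSphere_apply' _ (hcont.measurable hs),
    Measure.toSphere_apply' _ hs]
  congr 1
  have hcone : Set.Ioo (0 : ℝ) 1 • (Subtype.val '' (f.onSphere ⁻¹' s)) =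
      f ⁻¹' (Set.Ioo (0 : ℝ) 1 • (Subtype.val '' s)) := by
    ext x
    simp only [Set.mem_smul, Set.mem_image, Set.mem_preimage]
    constructor
    · rintro ⟨r, hr, _, ⟨y, hy, rfl⟩, rfl⟩
      exact ⟨r, hr, _, ⟨_, hy, rfl⟩, by simp [onSphere]⟩
    · rintro ⟨r, hr, _, ⟨y, hy, rfl⟩, hx⟩
      have hy' : f.onSphere (f.symm.onSphere y) = y := Subtype.ext (by simp [onSphere])
      refine ⟨r, hr, _, ⟨f.symm.onSphere y, by rwa [hy'], rfl⟩, ?_⟩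
      apply f.injective
      rw [← hx]
      simp [onSphere]
  rw [hcone]
  exact (f.measurePreserving_addHaar μ).measure_preimage_equiv
    (f := f.toHomeomorph.toMeasurableEquiv) _

variable {ι : Type*} [Fintype ι]

instance haarState.isProbabilityMeasure [Nonempty ι] : IsProbabilityMeasure (haarState ι) := by
  constructor
  rw [haarState, Measure.smul_apply, smul_eq_mul]
  refine ENNReal.inv_mul_cancel ?_ (measure_ne_top _ _)
  rw [Ne, Measure.measure_univ_eq_zero]
  exact Measure.toSphere_ne_zero _

/-- The Householder reflection along `v`: the reflection in the hyperplane orthogonal to `v`. -/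
def householder (v : EuclideanSpace ℂ ι) : EuclideanSpace ℂ ι ≃ₗᵢ[ℝ] EuclideanSpace ℂ ι :=
  { (ℂ ∙ v)ᗮ.reflection.toLinearEquiv.restrictScalars ℝ with
    norm_map' := (ℂ ∙ v)ᗮ.reflection.norm_map }

theorem householder_apply (v x : EuclideanSpace ℂ ι) (i : ι) :
    householder v x i = x i - 2 * (inner ℂ v x / ((‖v‖ : ℂ) ^ 2)) * v i := by
  have : householder v x = (ℂ ∙ v)ᗮ.reflection x := rfl
  rw [this, Submodule.reflection_orthogonal_apply, Submodule.reflection_singleton_apply]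
  simp [two_mul]
  ring

/-- Haar averages are invariant under Householder reflections. All symmetries of the Haar measure
used below (sign changes and exchanges of coordinates, rotations in a coordinate plane) are of this
form. -/
theorem integral_householder (v : EuclideanSpace ℂ ι) (F : EuclideanSpace ℂ ι → ℝ)
    (hF : Continuous F) :
    ∫ ψ, F (householder v ψ.1) ∂haarState ι = ∫ ψ, F ψ.1 ∂haarState ι := by
  have hmp : MeasurePreserving (householder v).onSphere (haarState ι) (haarState ι) :=
    ((householder v).measurePreserving_onSphere volume).smul_measure _
  have := integral_map (μ := haarState ι) hmp.measurable.aemeasurable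
    (f := fun ψ => F ψ.1) (hF.comp continuous_subtype_val).aestronglyMeasurable
  rw [hmp.map_eq] at this
  exact this.symm

theorem integrable_haarState [Nonempty ι] {F : sphere (0 : EuclideanSpace ℂ ι) 1 → ℝ}
    (hF : Continuous F) : Integrable F (haarState ι) :=
  hF.integrable_of_hasCompactSupport (HasCompactSupport.of_compactSpace F)

/-- The second absolute moments `𝔼 |ψ_i|² |ψ_j|²` of a Haar-random state. -/
def haarMoment (i j : ι) : ℝ := ∫ ψ, ‖ψ.1 i‖ ^ 2 * ‖ψ.1 j‖ ^ 2 ∂haarState ι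

theorem haarMoment_comm (i j : ι) : haarMoment i j = haarMoment j i := by
  simp only [haarMoment, mul_comm]

theorem haarMoment_nonneg (i j : ι) : 0 ≤ haarMoment i j :=
  integral_nonneg fun _ => by positivity

theorem sum_haarMoment [Nonempty ι] : ∑ i : ι, ∑ j : ι, haarMoment i j = 1 := by
  have hint : ∀ i j : ι, Integrable
      (fun ψ : sphere (0 : EuclideanSpace ℂ ι) 1 => ‖ψ.1 i‖ ^ 2 * ‖ψ.1 j‖ ^ 2) (haarState ι) :=
    fun i j => integrable_haarState (by fun_prop)
  simp only [haarMoment]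
  simp_rw [← integral_finsetSum _ (fun j _ => hint _ j)]
  rw [← integral_finsetSum _ (fun i _ => integrable_finsetSum _ fun j _ => hint i j)]
  have : ∀ ψ : sphere (0 : EuclideanSpace ℂ ι) 1,
      ∑ i, ∑ j, ‖ψ.1 i‖ ^ 2 * ‖ψ.1 j‖ ^ 2 = 1 := by
    intro ψ
    have hψ : ∑ i, ‖ψ.1 i‖ ^ 2 = 1 := by
      rw [← EuclideanSpace.norm_sq_eq]; simp
    rw [← Finset.sum_mul_sum, hψ, one_mul]
  simp [this]

variable [DecidableEq ι]

/-- The Householder reflection along `e_i` changes the sign of the `i`-th coordinate. -/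
theorem householder_single (i k : ι) (x : EuclideanSpace ℂ ι) :
    householder (EuclideanSpace.single i 1) x k = if k = i then -x k else x k := by
  rw [householder_apply]
  by_cases h : k = i
  · subst h; simp [EuclideanSpace.inner_single_left]; ring
  · simp [h]

theorem inner_single_add_single (i j : ι) (s : ℝ) (x : EuclideanSpace ℂ ι) :
    inner ℂ (EuclideanSpace.single i 1 + EuclideanSpace.single j (s : ℂ)) x = x i + s * x j := by
  simp [EuclideanSpace.inner_single_left]

theorem norm_sq_single_add_single {i j : ι} (hij : i ≠ j) (s : ℝ) :
    ((‖(EuclideanSpace.single i 1 + EuclideanSpace.single j (s : ℂ) :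
      EuclideanSpace ℂ ι)‖ : ℝ) : ℂ) ^ 2 = 1 + (s : ℂ) ^ 2 := by
  have h := inner_single_add_single i j s
    (EuclideanSpace.single i 1 + EuclideanSpace.single j (s : ℂ))
  rw [inner_self_eq_norm_sq_to_K] at h
  simpa [hij, hij.symm, sq] using h

/-- The Householder reflection along `e_i - e_j` exchanges the coordinates `i` and `j`. -/
theorem householder_swap {i j : ι} (hij : i ≠ j) (k : ι) (x : EuclideanSpace ℂ ι) :
    householder (EuclideanSpace.single i 1 + EuclideanSpace.single j ((-1 : ℝ) : ℂ)) x k =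
      x (Equiv.swap i j k) := by
  rw [householder_apply, inner_single_add_single, norm_sq_single_add_single hij]
  by_cases h : k = i
  · subst h; simp [hij]; ring
  · by_cases h' : k = j
    · subst h'; simp [h]; ring
    · simp [h, h', Equiv.swap_apply_of_ne_of_ne]

/-- The Householder reflection along `e_i + s e_j` with `s = ± 2` is a rotation by the angle of the
`3`-`4`-`5` triangle, up to signs. -/
theorem householder_rotation {i j : ι} (hij : i ≠ j) {s : ℝ} (hs : s ^ 2 = 4)
    (x : EuclideanSpace ℂ ι) :
    householder (EuclideanSpace.single i 1 + EuclideanSpace.single j (s : ℂ)) x i =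
      (3 * x i - 2 * s * x j) / 5 := by
  have hs' : (s : ℂ) ^ 2 = 4 := by exact_mod_cast hs
  rw [householder_apply, inner_single_add_single, norm_sq_single_add_single hij, hs']
  simp [hij]
  ring

theorem haarMoment_swap {i j : ι} (hij : i ≠ j) (k l : ι) :
    haarMoment (Equiv.swap i j k) (Equiv.swap i j l) = haarMoment k l := by
  have h := integral_householder
    (EuclideanSpace.single i 1 + EuclideanSpace.single j ((-1 : ℝ) : ℂ))
    (fun ψ => ‖ψ k‖ ^ 2 * ‖ψ l‖ ^ 2) (by fun_prop)
  simp only [householder_swap hij] at h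
  exact h

theorem haarMoment_congr_right {i j k : ι} (hj : j ≠ i) (hk : k ≠ i) :
    haarMoment i j = haarMoment i k := by
  rcases eq_or_ne j k with rfl | hjk
  · rfl
  · simpa [Equiv.swap_apply_of_ne_of_ne hj.symm hk.symm] using (haarMoment_swap hjk i j).symm

theorem haarMoment_offDiag {i j k l : ι} (hij : j ≠ i) (hkl : l ≠ k) :
    haarMoment i j = haarMoment k l := by
  rcases eq_or_ne l i with rfl | hl
  · rw [haarMoment_congr_right hij hkl.symm, haarMoment_comm]
  · rw [haarMoment_congr_right hij hl, haarMoment_comm,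
      haarMoment_congr_right hl.symm hkl.symm, haarMoment_comm]

/-- The fourth moment of a coordinate is at most three times an off-diagonal second moment (in
fact it is twice that moment). This follows from averaging the invariance under the two rotations
`ψ_i ↦ (3 ψ_i ± 4 ψ_j) / 5`. -/
theorem haarMoment_self_le {i j : ι} (hij : i ≠ j) : haarMoment i i ≤ 3 * haarMoment i j := by
  have : Nonempty ι := ⟨i⟩
  have hrot : ∀ s : ℝ, s ^ 2 = 4 →
      ∫ ψ, ‖(3 * ψ.1 i - 2 * s * ψ.1 j) / 5‖ ^ 4 ∂haarState ι = haarMoment i i := by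
    intro s hs
    have h := integral_householder
      (EuclideanSpace.single i 1 + EuclideanSpace.single j (s : ℂ))
      (fun ψ => ‖ψ i‖ ^ 4) (by fun_prop)
    simp only [householder_rotation hij hs] at h
    rw [h, haarMoment]
    congr 1 with ψ
    ring
  have hp := hrot 2 (by norm_num)
  have hm := hrot (-2) (by norm_num)
  have hjj : haarMoment j j = haarMoment i i := by simpa using haarMoment_swap hij i i
  have hint : ∀ k l : ι, Integrable
      (fun ψ : sphere (0 : EuclideanSpace ℂ ι) 1 => ‖ψ.1 k‖ ^ 2 * ‖ψ.1 l‖ ^ 2) (haarState ι) :=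
    fun k l => integrable_haarState (by fun_prop)
  have hineq : ∀ u v : ℂ, ‖(3 * u - 2 * ((2 : ℝ) : ℂ) * v) / 5‖ ^ 4 +
      ‖(3 * u - 2 * ((-2 : ℝ) : ℂ) * v) / 5‖ ^ 4 ≤
      162 / 625 * (‖u‖ ^ 2 * ‖u‖ ^ 2) + 512 / 625 * (‖v‖ ^ 2 * ‖v‖ ^ 2) +
        1728 / 625 * (‖u‖ ^ 2 * ‖v‖ ^ 2) := by
    intro u v
    have h4 : ∀ z : ℂ, ‖z‖ ^ 4 = (z.re ^ 2 + z.im ^ 2) ^ 2 := fun z => by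
      rw [← Complex.normSq_add_mul_I z.re z.im, Complex.re_add_im, Complex.normSq_eq_norm_sq]; ring
    have h2 : ∀ z : ℂ, ‖z‖ ^ 2 = z.re ^ 2 + z.im ^ 2 := fun z => by
      rw [← Complex.normSq_add_mul_I z.re z.im, Complex.re_add_im, Complex.normSq_eq_norm_sq]
    have hre : ∀ s : ℝ, ((3 * u - 2 * (s : ℂ) * v) / 5).re = (3 * u.re - 2 * s * v.re) / 5 := by
      intro s; simp
    have him : ∀ s : ℝ, ((3 * u - 2 * (s : ℂ) * v) / 5).im = (3 * u.im - 2 * s * v.im) / 5 := by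
      intro s; simp
    rw [h4, h4, hre, hre, him, him, h2, h2]
    -- the defect is the Cauchy-Schwarz defect of `(Re (u v̄))² ≤ |u|² |v|²`
    nlinarith [sq_nonneg (u.re * v.im - u.im * v.re)]
  have hle : haarMoment i i + haarMoment i i ≤
      162 / 625 * haarMoment i i + 512 / 625 * haarMoment j j + 1728 / 625 * haarMoment i j := by
    conv_lhs => rw [← hp]
    conv_lhs => arg 2; rw [hp, ← hm]
    rw [← integral_add (integrable_haarState (by fun_prop)) (integrable_haarState (by fun_prop))]
    have hrhs : ∫ ψ : sphere (0 : EuclideanSpace ℂ ι) 1,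
        (162 / 625 * (‖ψ.1 i‖ ^ 2 * ‖ψ.1 i‖ ^ 2) + 512 / 625 * (‖ψ.1 j‖ ^ 2 * ‖ψ.1 j‖ ^ 2) +
          1728 / 625 * (‖ψ.1 i‖ ^ 2 * ‖ψ.1 j‖ ^ 2)) ∂haarState ι =
        162 / 625 * haarMoment i i + 512 / 625 * haarMoment j j + 1728 / 625 * haarMoment i j := by
      rw [integral_add (((hint i i).const_mul _).fun_add ((hint j j).const_mul _))
        ((hint i j).const_mul _), integral_add ((hint i i).const_mul _) ((hint j j).const_mul _)]
      simp only [integral_const_mul, haarMoment]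
    rw [← hrhs]
    exact integral_mono ((integrable_haarState (by fun_prop)))
      (integrable_haarState (by fun_prop)) fun ψ => hineq _ _
  rw [hjj] at hle
  linarith

theorem haarMoment_le (hι : 1 < Fintype.card ι) (i j : ι) :
    haarMoment i j ≤ 3 / (Fintype.card ι * (Fintype.card ι - 1)) := by
  have : Nonempty ι := ⟨i⟩
  have : Nontrivial ι := Fintype.one_lt_card_iff_nontrivial.1 hι
  obtain ⟨k, hk⟩ := exists_ne i
  have hcard : (1 : ℝ) < Fintype.card ι := by exact_mod_cast hι
  have hoff : (Fintype.card ι * (Fintype.card ι - 1) : ℝ) * haarMoment i k ≤ 1 := by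
    have hrow : ∀ a : ι, ((Fintype.card ι - 1 : ℝ)) * haarMoment i k ≤ ∑ b, haarMoment a b := by
      intro a
      rw [← Finset.add_sum_erase _ _ (Finset.mem_univ a),
        Finset.sum_congr rfl fun b hb => haarMoment_offDiag (Finset.ne_of_mem_erase hb) hk,
        Finset.sum_const, Finset.card_erase_of_mem (Finset.mem_univ a), Finset.card_univ,
        nsmul_eq_mul, Nat.cast_pred (by omega)]
      linarith [haarMoment_nonneg a a]
    have := Finset.sum_le_sum fun a (_ : a ∈ Finset.univ) => hrow a
    rw [Finset.sum_const, Finset.card_univ, nsmul_eq_mul, sum_haarMoment] at this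
    linarith
  have h3 : haarMoment i j ≤ 3 * haarMoment i k := by
    rcases eq_or_ne j i with rfl | hj
    · exact haarMoment_self_le hk.symm
    · rw [haarMoment_congr_right hj hk]
      linarith [haarMoment_nonneg i k]
  have hpos : (0 : ℝ) < Fintype.card ι * (Fintype.card ι - 1) :=
    mul_pos (by linarith) (by linarith)
  rw [le_div_iff₀ hpos]
  nlinarith [mul_le_mul_of_nonneg_left h3 hpos.le]

end Haar

/-! ### The average purity of a subsystem -/

noncomputable section Purity

open MeasureTheory Metric

variable {A B : Type*} [Fintype A] [Fintype B]

/-- The coefficient matrix of a bipartite state vector, `M a b = ψ (a, b)`. The reduced density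
matrix of the first system is `M * Mᴴ`. -/
def coeffMatrix (ψ : EuclideanSpace ℂ (A × B)) : Matrix A B ℂ :=
  Matrix.of fun a b => ψ (a, b)

/-- The purity `Tr ρ_A²` of the reduced state of `|ψ⟩⟨ψ|`, as the sum of the squared moduli of the
entries of `ρ_A`. -/
def purity (ψ : EuclideanSpace ℂ (A × B)) : ℝ :=
  ∑ a, ∑ a', ‖(coeffMatrix ψ * (coeffMatrix ψ)ᴴ) a a'‖ ^ 2

theorem purity_nonneg (ψ : EuclideanSpace ℂ (A × B)) : 0 ≤ purity ψ :=
  Finset.sum_nonneg fun _ _ => Finset.sum_nonneg fun _ _ => by positivity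

theorem purity_eq_sum (ψ : EuclideanSpace ℂ (A × B)) :
    purity ψ = ∑ a, ∑ a', ∑ b, ∑ b',
      (ψ (a, b) * star (ψ (a', b)) * (star (ψ (a, b')) * ψ (a', b'))).re := by
  unfold purity
  refine Finset.sum_congr rfl fun a _ => Finset.sum_congr rfl fun a' _ => ?_
  rw [← Complex.ofReal_re (‖_‖ ^ 2), Complex.ofReal_pow, ← Complex.mul_conj']
  simp [coeffMatrix, Matrix.mul_apply, Finset.sum_mul_sum, map_sum, Complex.re_sum]

theorem continuous_purity : Continuous (purity : EuclideanSpace ℂ (A × B) → ℝ) := by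
  have : (purity : EuclideanSpace ℂ (A × B) → ℝ) = fun ψ => _ := funext purity_eq_sum
  rw [this]
  fun_prop

variable [DecidableEq A] [DecidableEq B]

/-- A term of the purity averages to zero if its four coordinates are distinct: it is odd under a
sign change of one of them. -/
theorem integral_purity_term_eq_zero {a a' : A} {b b' : B} (ha : a' ≠ a) (hb : b' ≠ b) :
    ∫ ψ, (ψ.1 (a, b) * star (ψ.1 (a', b)) * (star (ψ.1 (a, b')) * ψ.1 (a', b'))).re
      ∂haarState (A × B) = 0 := by
  have h := integral_householder (EuclideanSpace.single (a, b) 1)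
    (fun ψ => (ψ (a, b) * star (ψ (a', b)) * (star (ψ (a, b')) * ψ (a', b'))).re) (by fun_prop)
  simp only [householder_single, Prod.mk.injEq, ha, hb, and_false, false_and, if_false, and_self,
    if_true, neg_mul, Complex.neg_re, integral_neg] at h
  linarith

theorem integral_purity_term_le (hcard : 1 < Fintype.card (A × B)) (a a' : A) (b b' : B) :
    ∫ ψ, (ψ.1 (a, b) * star (ψ.1 (a', b)) * (star (ψ.1 (a, b')) * ψ.1 (a', b'))).re
      ∂haarState (A × B) ≤
    (if a = a' then 3 / (Fintype.card (A × B) * (Fintype.card (A × B) - 1) : ℝ) else 0) +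
      (if b = b' then 3 / (Fintype.card (A × B) * (Fintype.card (A × B) - 1) : ℝ) else 0) := by
  have hcard' : (1 : ℝ) < Fintype.card (A × B) := by exact_mod_cast hcard
  have hc : (0 : ℝ) ≤ 3 / (Fintype.card (A × B) * (Fintype.card (A × B) - 1)) :=
    div_nonneg (by norm_num) (mul_nonneg (by linarith) (by linarith))
  have hsq : ∀ z : ℂ, (‖z‖ ^ 2 : ℝ) = z.re * z.re + z.im * z.im := fun z => by
    rw [← Complex.normSq_eq_norm_sq, Complex.normSq_apply]
  by_cases ha : a = a'
  · subst ha
    refine le_trans (le_of_eq ?_) (le_add_of_le_of_nonneg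
      (le_of_le_of_eq (haarMoment_le hcard (a, b) (a, b')) (if_pos rfl).symm) ?_)
    · rw [haarMoment]
      congr 1 with ψ
      rw [hsq, hsq]
      simp only [Complex.mul_re, Complex.mul_im, Complex.star_def, Complex.conj_re, Complex.conj_im]
      ring
    · split_ifs
      exacts [hc, le_rfl]
  · by_cases hb : b = b'
    · subst hb
      rw [if_neg ha, zero_add, if_pos rfl]
      refine le_trans (le_of_eq ?_) (haarMoment_le hcard (a, b) (a', b))
      rw [haarMoment]
      congr 1 with ψ
      rw [hsq, hsq]
      simp only [Complex.mul_re, Complex.mul_im, Complex.star_def, Complex.conj_re, Complex.conj_im]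
      ring
    · rw [integral_purity_term_eq_zero (Ne.symm ha) (Ne.symm hb), if_neg ha, if_neg hb, add_zero]

theorem integral_purity_le (hcard : 1 < Fintype.card (A × B)) :
    ∫ ψ, purity ψ.1 ∂haarState (A × B) ≤
      3 * (Fintype.card A + Fintype.card B) / (Fintype.card A * Fintype.card B - 1) := by
  have : Nonempty (A × B) := Fintype.card_pos_iff.1 (by omega)
  have hint : ∀ (a a' : A) (b b' : B), Integrable
      (fun ψ : sphere (0 : EuclideanSpace ℂ (A × B)) 1 =>
        (ψ.1 (a, b) * star (ψ.1 (a', b)) * (star (ψ.1 (a, b')) * ψ.1 (a', b'))).re)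
      (haarState (A × B)) := fun a a' b b' => integrable_haarState (by fun_prop)
  simp_rw [purity_eq_sum]
  rw [integral_finsetSum _ fun a _ => integrable_finsetSum _ fun a' _ =>
    integrable_finsetSum _ fun b _ => integrable_finsetSum _ fun b' _ => hint a a' b b']
  simp_rw [integral_finsetSum _ fun a' _ =>
    integrable_finsetSum _ fun b _ => integrable_finsetSum _ fun b' _ => hint _ a' b b',
    integral_finsetSum _ fun b _ => integrable_finsetSum _ fun b' _ => hint _ _ b b',
    integral_finsetSum _ fun b' _ => hint _ _ _ b']
  refine (Finset.sum_le_sum fun a _ => Finset.sum_le_sum fun a' _ => Finset.sum_le_sum fun b _ =>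
    Finset.sum_le_sum fun b' _ => integral_purity_term_le hcard a a' b b').trans (le_of_eq ?_)
  have hne : (Fintype.card A * Fintype.card B - 1 : ℝ) ≠ 0 := by
    have : (1 : ℝ) < Fintype.card A * Fintype.card B := by
      rw [Fintype.card_prod] at hcard
      exact_mod_cast hcard
    linarith
  have hA : (Fintype.card A : ℝ) ≠ 0 := by
    have := this.map Prod.fst
    simp
  have hB : (Fintype.card B : ℝ) ≠ 0 := by
    have := this.map Prod.snd
    simp
  simp only [Finset.sum_add_distrib, Finset.sum_ite_eq, Finset.mem_univ, if_true,
    Finset.sum_const, Finset.card_univ, nsmul_eq_mul, Fintype.card_prod, Nat.cast_mul,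
    ← Finset.mul_sum]
  field_simp
  ring

end Purity

/-! ### Time evolution under a Hamiltonian with `H³ = 4 H` -/

noncomputable section Evolution

open Complex

variable {ι : Type*} [Fintype ι] [DecidableEq ι]

theorem NormedSpace.exp_smul_of_mul_self {𝔸 : Type*} [NormedRing 𝔸] [NormedAlgebra ℂ 𝔸]
    [CompleteSpace 𝔸] {p : 𝔸} (hp : p * p = p) (s : ℂ) :
    NormedSpace.exp (s • p) = 1 + (Complex.exp s - 1) • p := by
  have hs : HasSum (fun n : ℕ => ((n.factorial : ℂ)⁻¹ * s ^ n) • p) (Complex.exp s • p) := by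
    have h := NormedSpace.exp_series_hasSum_exp' (𝕂 := ℂ) s
    rw [← Complex.exp_eq_exp_ℂ] at h
    exact h.smul_const p
  have hs' := hs.add (hasSum_ite_eq (0 : ℕ) (1 - p))
  have hexp := NormedSpace.exp_series_hasSum_exp' (𝕂 := ℂ) (s • p)
  refine hexp.unique ?_
  have hsum : Complex.exp s • p + (1 - p) = 1 + (Complex.exp s - 1) • p := by
    rw [sub_smul, one_smul]; abel
  rw [← hsum]
  convert hs' using 1
  funext n
  rcases n with _ | n
  · simp
  · have hpow : ∀ m : ℕ, p ^ (m + 1) = p := fun m => by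
      induction m with
      | zero => simp
      | succ m ih => rw [pow_succ, ih, hp]
    simp [smul_pow, hpow, smul_smul]

theorem Matrix.exp_smul_of_mul_self {p : Matrix ι ι ℂ} (hp : p * p = p) (s : ℂ) :
    NormedSpace.exp (s • p) = 1 + (Complex.exp s - 1) • p := by
  let : NormedRing (Matrix ι ι ℂ) := Matrix.linftyOpNormedRing
  let : NormedAlgebra ℂ (Matrix ι ι ℂ) := Matrix.linftyOpNormedAlgebra
  exact NormedSpace.exp_smul_of_mul_self hp s

/-- If `H³ = 4 H`, then `H` is diagonalizable with eigenvalues in `{0, 2, -2}`, and its evolution is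
a quadratic polynomial in `H`. -/
theorem evolution_of_cube {H : Matrix ι ι ℂ} (hH : H * H * H = (4 : ℂ) • H) (t : ℝ) :
    evolution H t = 1 + ((Complex.cos (2 * t) - 1) / 4) • (H * H) +
      (-(I * Complex.sin (2 * t)) / 2) • H := by
  -- the spectral projections for the eigenvalues `2` and `-2`
  set p : Matrix ι ι ℂ := (8 : ℂ)⁻¹ • (H * H + (2 : ℂ) • H) with hp
  set q : Matrix ι ι ℂ := (8 : ℂ)⁻¹ • (H * H - (2 : ℂ) • H) with hq
  have h3 : H * (H * H) = (4 : ℂ) • H := by rw [← mul_assoc, hH]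
  have hpp : p * p = p := by
    simp only [hp, smul_mul_assoc, mul_smul_comm, mul_add, add_mul, mul_assoc, h3]
    module
  have hqq : q * q = q := by
    simp only [hq, smul_mul_assoc, mul_smul_comm, mul_sub, sub_mul, mul_assoc, h3]
    module
  have hpq : p * q = 0 := by
    simp only [hp, hq, smul_mul_assoc, mul_smul_comm, mul_sub, add_mul, mul_assoc, h3]
    module
  have hqp : q * p = 0 := by
    simp only [hp, hq, smul_mul_assoc, mul_smul_comm, mul_add, sub_mul, mul_assoc, h3]
    module
  have hdecomp : (-I * (t : ℂ)) • H = (-(2 * t * I)) • p + (2 * t * I) • q := by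
    rw [hp, hq]; module
  have hcomm : Commute ((-(2 * t * I)) • p) ((2 * t * I) • q) := by
    have : Commute p q := hpq.trans hqp.symm
    exact (this.smul_left _).smul_right _
  rw [evolution, hdecomp, Matrix.exp_add_of_commute _ _ hcomm,
    Matrix.exp_smul_of_mul_self hpp, Matrix.exp_smul_of_mul_self hqq]
  have hprod : ∀ x y : ℂ, (1 + x • p) * (1 + y • q) = 1 + x • p + y • q := by
    intro x y
    rw [mul_add, add_mul, add_mul, smul_mul_smul_comm, hpq, smul_zero]
    simp
  rw [hprod, neg_mul_eq_neg_mul, Complex.exp_mul_I, Complex.exp_mul_I, Complex.cos_neg,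
    Complex.sin_neg, hp, hq]
  module

theorem conjTranspose_evolution_mul_self {H : Matrix ι ι ℂ} (hH : H.IsHermitian) (t : ℝ) :
    (evolution H t)ᴴ * evolution H t = 1 := by
  have h : ((-I * (t : ℂ)) • H)ᴴ = -((-I * (t : ℂ)) • H) := by
    rw [Matrix.conjTranspose_smul, hH.eq]
    simp
  rw [evolution, ← Matrix.exp_conjTranspose, h,
    ← Matrix.exp_add_of_commute _ _ (Commute.refl ((-I * (t : ℂ)) • H)).neg_left, neg_add_cancel,
    NormedSpace.exp_zero]

end Evolution

/-! ### The ancilla circuit -/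

noncomputable section Circuit

variable {h k : Type*}

theorem controlledHamiltonian_add (H H' : Matrix (h × k) (h × k) ℂ) :
    controlledHamiltonian (H + H') = controlledHamiltonian H + controlledHamiltonian H' := by
  ext; simp [controlledHamiltonian, mul_add]

theorem controlledHamiltonian_smul (c : ℂ) (H : Matrix (h × k) (h × k) ℂ) :
    controlledHamiltonian (c • H) = c • controlledHamiltonian H := by
  ext; simp [controlledHamiltonian, mul_left_comm]

theorem isHermitian_controlledHamiltonian {H : Matrix (h × k) (h × k) ℂ} (hH : H.IsHermitian) :
    (controlledHamiltonian H).IsHermitian := by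
  ext ⟨x, c, y⟩ ⟨x', c', y'⟩
  have := hH.apply (x, y) (x', y')
  fin_cases c <;> fin_cases c' <;> simp [controlledHamiltonian, Matrix.conjTranspose_apply]
  simpa using this

variable [Fintype h]

theorem trFirst_add (M N : Matrix (h × k) (h × k) ℂ) :
    trFirst (M + N) = trFirst M + trFirst N := by
  ext; simp [trFirst, Finset.sum_add_distrib]

theorem trFirst_sub (M N : Matrix (h × k) (h × k) ℂ) :
    trFirst (M - N) = trFirst M - trFirst N := by
  ext; simp [trFirst]

theorem trFirst_smul (c : ℂ) (M : Matrix (h × k) (h × k) ℂ) :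
    trFirst (c • M) = c • trFirst M := by
  ext; simp [trFirst, Finset.mul_sum]

theorem conjTranspose_trFirst (M : Matrix (h × k) (h × k) ℂ) : (trFirst M)ᴴ = trFirst Mᴴ := by
  ext; simp [trFirst, Matrix.conjTranspose_apply]

theorem trFirst_kronecker (ρ : Matrix h h ℂ) (σ : Matrix k k ℂ) :
    trFirst (ρ ⊗ₖ σ) = ρ.trace • σ := by
  ext; simp [trFirst, Matrix.trace, Finset.sum_mul]

variable [Fintype k]

theorem trace_trFirst (M : Matrix (h × k) (h × k) ℂ) : (trFirst M).trace = M.trace := by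
  simp only [Matrix.trace, trFirst, Matrix.diag_apply, Matrix.of_apply, Fintype.sum_prod_type]
  exact Finset.sum_comm

theorem trFirst_mul_one_kronecker [DecidableEq h] (M : Matrix (h × k) (h × k) ℂ)
    (σ : Matrix k k ℂ) :
    trFirst (M * ((1 : Matrix h h ℂ) ⊗ₖ σ)) = trFirst M * σ := by
  ext y y'
  simp only [trFirst, Matrix.of_apply, Matrix.mul_apply, Fintype.sum_prod_type,
    Matrix.kroneckerMap_apply, Matrix.one_apply, Finset.sum_mul]
  rw [Finset.sum_comm]
  simp [Finset.sum_comm (γ := k)]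

theorem controlledHamiltonian_mul (H H' : Matrix (h × k) (h × k) ℂ) :
    controlledHamiltonian (H * H') = controlledHamiltonian H * controlledHamiltonian H' := by
  ext ⟨x, c, y⟩ ⟨x', c', y'⟩
  simp only [controlledHamiltonian, Matrix.of_apply, Matrix.mul_apply, Fintype.sum_prod_type,
    Fin.sum_univ_two, Finset.mul_sum, ← Finset.sum_add_distrib]
  refine Finset.sum_congr rfl fun _ _ => Finset.sum_congr rfl fun _ _ => ?_
  fin_cases c <;> fin_cases c' <;> simp

variable [DecidableEq h] [DecidableEq k]

/-- The controlled evolution acts as the identity if the control qubit is `0`, and as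
`e^{-iHt}` if it is `1`. -/
theorem evolution_controlledHamiltonian {H : Matrix (h × k) (h × k) ℂ}
    (hH : H * H * H = (4 : ℂ) • H) (t : ℝ) :
    evolution (controlledHamiltonian H) t = 1 + controlledHamiltonian (evolution H t - 1) := by
  rw [evolution_of_cube (by
      rw [← controlledHamiltonian_mul, ← controlledHamiltonian_mul, hH,
        controlledHamiltonian_smul]), evolution_of_cube hH, add_assoc, add_assoc,
    add_sub_cancel_left, controlledHamiltonian_add, controlledHamiltonian_smul,
    controlledHamiltonian_smul,
    controlledHamiltonian_mul]

/-- The operator `Tr₁ [U (ρ ⊗ 1)]` by which one step of the circuit multiplies the coherence of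
the ancilla. -/
def memoryOp (U : Matrix (h × k) (h × k) ℂ) (ρ : Matrix h h ℂ) : Matrix k k ℂ :=
  trFirst (U * (ρ ⊗ₖ (1 : Matrix k k ℂ)))

/-- The block `⟨1| τ |0⟩` of a state of the ancilla and the memory. -/
def coherence (τ : Matrix (Fin 2 × k) (Fin 2 × k) ℂ) : Matrix k k ℂ :=
  τ.submatrix (Prod.mk 1) (Prod.mk 0)

theorem coherence_hmeStep {H : Matrix (h × k) (h × k) ℂ}
    (hH : H * H * H = (4 : ℂ) • H) (t : ℝ) (ρ : Matrix h h ℂ)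
    (τ : Matrix (Fin 2 × k) (Fin 2 × k) ℂ) :
    coherence (hmeStep (controlledHamiltonian H) t ρ τ) =
      memoryOp (evolution H t) ρ * coherence τ := by
  set W := evolution H t - 1 with hW
  have hU : evolution H t = 1 + W := by rw [hW]; abel
  have hrow : ∀ (M : Matrix (h × (Fin 2 × k)) (h × (Fin 2 × k)) ℂ) (x : h) (y : k)
      (r : h × (Fin 2 × k)), ((1 + controlledHamiltonian W) * M) (x, (1, y)) r =
        ∑ x', ∑ y', (1 + W) (x, y) (x', y') * M (x', (1, y')) r := by
    intro M x y r
    rw [add_mul, one_mul, Matrix.add_apply]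
    simp only [Matrix.add_apply, add_mul, Finset.sum_add_distrib]
    congr 1
    · simp [Matrix.one_apply, Prod.ext_iff, ite_and]
    · simp [Matrix.mul_apply, Fintype.sum_prod_type, controlledHamiltonian]
  have hcol : ∀ (M : Matrix (h × (Fin 2 × k)) (h × (Fin 2 × k)) ℂ) (x : h) (y : k)
      (r : h × (Fin 2 × k)), (M * ((1 + controlledHamiltonian W)ᴴ :
        Matrix (h × (Fin 2 × k)) (h × (Fin 2 × k)) ℂ)) r (x, (0, y)) =
        M r (x, (0, y)) := by
    intro M x y r
    rw [Matrix.conjTranspose_add, Matrix.conjTranspose_one, mul_add, mul_one, Matrix.add_apply]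
    simp [Matrix.mul_apply, controlledHamiltonian, Matrix.conjTranspose_apply]
  have hstep : coherence (hmeStep (controlledHamiltonian H) t ρ τ) =
      trFirst ((1 + W) * (ρ ⊗ₖ coherence τ)) := by
    rw [hmeStep, evolution_controlledHamiltonian hH, ← hW]
    ext y y'
    simp only [coherence, Matrix.submatrix_apply, trFirst, Matrix.of_apply, hcol, hrow,
      Matrix.kroneckerMap_apply]
    refine Finset.sum_congr rfl fun x _ => ?_
    simp only [Matrix.mul_apply, Fintype.sum_prod_type, Matrix.kroneckerMap_apply,
      Matrix.submatrix_apply]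
  rw [hstep, memoryOp, hU, ← trFirst_mul_one_kronecker, mul_assoc, ← Matrix.mul_kronecker_mul,
    mul_one, one_mul]

theorem trace_hmeStep {H : Matrix (h × k) (h × k) ℂ} (hH : H.IsHermitian) (t : ℝ)
    (ρ : Matrix h h ℂ) (σ : Matrix k k ℂ) :
    (hmeStep H t ρ σ).trace = ρ.trace * σ.trace := by
  rw [hmeStep, trace_trFirst, Matrix.trace_mul_comm, ← mul_assoc,
    conjTranspose_evolution_mul_self hH, one_mul, Matrix.trace_kronecker]

theorem isHermitian_hmeStep (H : Matrix (h × k) (h × k) ℂ) (t : ℝ)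
    {ρ : Matrix h h ℂ} {σ : Matrix k k ℂ} (hρ : ρ.IsHermitian) (hσ : σ.IsHermitian) :
    (hmeStep H t ρ σ).IsHermitian := by
  rw [Matrix.IsHermitian, hmeStep, conjTranspose_trFirst]
  simp [Matrix.conjTranspose_mul, Matrix.conjTranspose_kronecker, hρ.eq, hσ.eq, mul_assoc]

theorem hadamardOnAncilla_apply (τ : Matrix (Fin 2 × k) (Fin 2 × k) ℂ) (c c' : Fin 2) (y y' : k) :
    hadamardOnAncilla τ (c, y) (c', y') =
      ∑ d, ∑ d', hadamardGate c d * τ (d, y) (d', y') * star (hadamardGate c' d') := by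
  simp [hadamardOnAncilla, Matrix.mul_apply, Fintype.sum_prod_type, Matrix.one_apply,
    Finset.sum_add_distrib, apply_ite (starRingEnd ℂ)]
  ring

theorem inv_sqrt_two_mul_self : ((Real.sqrt 2 : ℂ)⁻¹) * (Real.sqrt 2 : ℂ)⁻¹ = 1 / 2 := by
  rw [← mul_inv, ← Complex.ofReal_mul, Real.mul_self_sqrt (by norm_num)]
  norm_num

theorem hadamardOnAncilla_zero (ρ : Matrix k k ℂ) (c c' : Fin 2) (y y' : k) :
    hadamardOnAncilla ((Matrix.single 0 0 1 : Matrix (Fin 2) (Fin 2) ℂ) ⊗ₖ ρ) (c, y) (c', y') =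
      ρ y y' / 2 := by
  rw [hadamardOnAncilla_apply]
  have := inv_sqrt_two_mul_self
  fin_cases c <;> fin_cases c' <;> simp [hadamardGate, Fin.sum_univ_two] <;>
    linear_combination ρ y y' * this

theorem trace_measurement {τ : Matrix (Fin 2 × k) (Fin 2 × k) ℂ} (hτ : τ.IsHermitian)
    (htr : τ.trace = 1) (b : Fin 2) :
    (((Matrix.single b b 1 : Matrix (Fin 2) (Fin 2) ℂ) ⊗ₖ (1 : Matrix k k ℂ)) *
      hadamardOnAncilla τ).trace.re = 1 / 2 + (-1) ^ (b : ℕ) * (coherence τ).trace.re := by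
  have hproj : (((Matrix.single b b 1 : Matrix (Fin 2) (Fin 2) ℂ) ⊗ₖ (1 : Matrix k k ℂ)) *
      hadamardOnAncilla τ).trace = ∑ y, hadamardOnAncilla τ (b, y) (b, y) := by
    simp only [Matrix.trace, Matrix.diag_apply, Matrix.mul_apply, Fintype.sum_prod_type,
      Matrix.kroneckerMap_apply, Matrix.one_apply]
    fin_cases b <;> simp
  have hentry : ∀ y, hadamardOnAncilla τ (b, y) (b, y) =
      (τ (0, y) (0, y) + τ (1, y) (1, y)) / 2 +
        (-1) ^ (b : ℕ) * ((τ (1, y) (0, y) + star (τ (1, y) (0, y))) / 2) := by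
    intro y
    have h := inv_sqrt_two_mul_self
    rw [hadamardOnAncilla_apply, hτ.apply (0, y) (1, y)]
    fin_cases b <;> simp [hadamardGate, Fin.sum_univ_two]
    · linear_combination (τ (0, y) (0, y) + τ (1, y) (1, y) + τ (1, y) (0, y) + τ (0, y) (1, y)) * h
    · linear_combination (τ (0, y) (0, y) + τ (1, y) (1, y) - τ (1, y) (0, y) - τ (0, y) (1, y)) * h
  have htr' : ∑ y, (τ (0, y) (0, y) + τ (1, y) (1, y)) = 1 := by
    rw [← htr, Finset.sum_add_distrib]
    simp [Matrix.trace, Fintype.sum_prod_type]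
  have hre : ∀ z : ℂ, (z + star z) / 2 = (z.re : ℂ) := fun z => by
    rw [Complex.star_def, Complex.add_conj]; push_cast; ring
  simp only [hproj, hentry, hre]
  rw [Finset.sum_add_distrib, ← Finset.sum_div, htr', ← Finset.mul_sum, ← Complex.ofReal_sum,
    coherence, Matrix.trace, Complex.re_sum]
  have hsign : ((-1) ^ (b : ℕ) : ℂ) = (((-1) ^ (b : ℕ) : ℝ) : ℂ) := by push_cast; rfl
  rw [hsign, Complex.add_re, Complex.re_ofReal_mul, Complex.ofReal_re]
  simp

/-- The outcome statistics of the circuit are determined by the coherence of the ancilla, which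
each step multiplies by `memoryOp`. -/
theorem outcomeProb_eq {H : Matrix (k × k) (k × k) ℂ} (hH : H.IsHermitian)
    (hH3 : H * H * H = (4 : ℂ) • H) (t : ℝ) (K : ℕ) {ρ : Matrix k k ℂ} (hρ : ρ.IsHermitian)
    (htr : ρ.trace = 1) (b : Fin 2) :
    outcomeProb H t K ρ b =
      1 / 2 + (-1) ^ (b : ℕ) * ((memoryOp (evolution H (t / K)) ρ ^ K * ρ).trace.re / 2) := by
  have hiter : ∀ j : ℕ,
      let τ := (hmeStep (controlledHamiltonian H) (t / K) ρ)^[j]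
        (hadamardOnAncilla ((Matrix.single 0 0 1 : Matrix (Fin 2) (Fin 2) ℂ) ⊗ₖ ρ))
      τ.IsHermitian ∧ τ.trace = 1 ∧
        coherence τ = memoryOp (evolution H (t / K)) ρ ^ j * ((1 / 2 : ℂ) • ρ) := by
    intro j
    induction j with
    | zero =>
      refine ⟨?_, ?_, ?_⟩
      · ext ⟨c, y⟩ ⟨c', y'⟩
        simp [Matrix.conjTranspose_apply, hadamardOnAncilla_zero, ← hρ.apply y y']
      · simp only [Function.iterate_zero_apply, Matrix.trace, Matrix.diag_apply,
          Fintype.sum_prod_type, Fin.sum_univ_two, hadamardOnAncilla_zero, ← Finset.sum_add_distrib,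
          add_halves]
        exact htr
      · ext y y'
        simp [coherence, hadamardOnAncilla_zero]
        ring
    | succ j ih =>
      obtain ⟨h1, h2, h3⟩ := ih
      simp only [Function.iterate_succ_apply']
      refine ⟨isHermitian_hmeStep _ _ hρ h1, ?_, ?_⟩
      · rw [trace_hmeStep (isHermitian_controlledHamiltonian hH), h2, htr, one_mul]
      · rw [coherence_hmeStep hH3, h3, pow_succ', mul_assoc]
  obtain ⟨h1, h2, h3⟩ := hiter K
  rw [outcomeProb, circuitOutput, trace_measurement h1 h2, h3, Matrix.mul_smul, Matrix.trace_smul]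
  congr 2
  have hhalf : (1 / 2 : ℂ) = ((1 / 2 : ℝ) : ℂ) := by push_cast; rfl
  rw [smul_eq_mul, hhalf, Complex.re_ofReal_mul]
  ring

end Circuit

/-! ### The reduction Hamiltonian -/

noncomputable section Reduction

variable {A B : Type*}

/-- The exchange of the first components of two pairs. -/
def swapFirst (A B : Type*) : Equiv.Perm ((A × B) × (A × B)) where
  toFun p := ((p.2.1, p.1.2), (p.1.1, p.2.2))
  invFun p := ((p.2.1, p.1.2), (p.1.1, p.2.2))
  left_inv _ := rfl
  right_inv _ := rfl

/-- The exchange of the second components of two pairs. -/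
def swapSecond (A B : Type*) : Equiv.Perm ((A × B) × (A × B)) where
  toFun p := ((p.1.1, p.2.2), (p.2.1, p.1.2))
  invFun p := ((p.1.1, p.2.2), (p.2.1, p.1.2))
  left_inv _ := rfl
  right_inv _ := rfl

theorem permMatrix_apply {ι : Type*} [DecidableEq ι] (σ : Equiv.Perm ι) (p q : ι) :
    σ.permMatrix ℂ p q = if σ p = q then 1 else 0 := by
  simp [Equiv.Perm.permMatrix, PEquiv.toMatrix_apply, Equiv.toPEquiv_apply, eq_comm]

variable [DecidableEq A] [DecidableEq B]

theorem reductionHamiltonian_eq :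
    reductionHamiltonian A B = (swapSecond A B).permMatrix ℂ -
      (swapFirst A B * swapSecond A B).permMatrix ℂ := by
  ext ⟨⟨a, b⟩, ⟨c, d⟩⟩ ⟨⟨a', b'⟩, ⟨c', d'⟩⟩
  simp only [reductionHamiltonian, Matrix.sub_apply, permMatrix_apply, Matrix.reindex_apply,
    Matrix.submatrix_apply, Matrix.kroneckerMap_apply, swapOp, Matrix.of_apply, Matrix.one_apply,
    swapSecond, swapFirst, Equiv.Perm.mul_apply, Equiv.coe_fn_mk, Equiv.prodProdProdComm_symm,
    Equiv.prodProdProdComm_apply, Prod.swap_prod_mk, Prod.mk.injEq, ← ite_and, mul_ite, mul_one,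
    mul_zero]
  congr 2
  · apply propext; tauto
  · apply propext; tauto

theorem hmeHamiltonian_partialReduction [Fintype A] :
    hmeHamiltonian (partialReduction A B) = reductionHamiltonian A B := by
  rw [reductionHamiltonian_eq]
  ext ⟨⟨a, b⟩, ⟨c, d⟩⟩ ⟨⟨a', b'⟩, ⟨c', d'⟩⟩
  simp only [hmeHamiltonian, transposeFirst, choiMatrix, partialReduction, Matrix.of_apply,
    LinearMap.coe_mk, AddHom.coe_mk, Matrix.sub_apply, Matrix.kroneckerMap_apply, trFirst,
    Matrix.single_apply, Matrix.one_apply, permMatrix_apply, swapSecond, swapFirst,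
    Equiv.Perm.mul_apply, Equiv.coe_fn_mk, Prod.mk.injEq]
  congr 1
  · have : ∀ x : A, ((a' = x ∧ b' = d) ∧ a = x ∧ b = d') ↔
        (x = a' ∧ (a = a' ∧ b' = d ∧ b = d')) := by
      intro x; constructor
      · rintro ⟨⟨rfl, rfl⟩, rfl, rfl⟩; simp
      · rintro ⟨rfl, rfl, rfl, rfl⟩; simp
    simp only [this, ite_and, Finset.sum_ite_eq', Finset.mem_univ, if_true]
    simp only [← ite_and, ite_mul, one_mul, zero_mul]
    congr 1
    apply propext; tauto
  · congr 1
    apply propext; tauto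

theorem isHermitian_reductionHamiltonian : (reductionHamiltonian A B).IsHermitian := by
  rw [reductionHamiltonian_eq, Matrix.IsHermitian, Matrix.conjTranspose_sub,
    Matrix.conjTranspose_permMatrix, Matrix.conjTranspose_permMatrix]
  rfl

variable [Fintype A] [Fintype B]

/-- `H_R = (1 - S_A) S_B` with commuting involutions, so `H_R² = (1 - S_A)² = 2 (1 - S_A)`. -/
theorem reductionHamiltonian_sq :
    reductionHamiltonian A B * reductionHamiltonian A B =
      (2 : ℂ) • (1 - (swapFirst A B).permMatrix ℂ) := by
  have h1 : swapFirst A B * swapSecond A B * swapSecond A B = swapFirst A B := rfl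
  have h2 : swapSecond A B * (swapFirst A B * swapSecond A B) = swapFirst A B := rfl
  have h3 : swapFirst A B * swapSecond A B * (swapFirst A B * swapSecond A B) = 1 := rfl
  have h4 : swapSecond A B * swapSecond A B = 1 := rfl
  rw [reductionHamiltonian_eq]
  simp only [mul_sub, sub_mul, ← Matrix.permMatrix_mul, h1, h2, h3, h4,
    Matrix.permMatrix_one]
  module

theorem reductionHamiltonian_cube :
    reductionHamiltonian A B * reductionHamiltonian A B * reductionHamiltonian A B =
      (4 : ℂ) • reductionHamiltonian A B := by
  have h1 : swapSecond A B * swapFirst A B = swapFirst A B * swapSecond A B := rfl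
  have h2 : swapFirst A B * swapSecond A B * swapFirst A B = swapSecond A B := rfl
  rw [reductionHamiltonian_sq, reductionHamiltonian_eq]
  simp only [mul_sub, sub_mul, smul_mul_assoc, ← Matrix.permMatrix_mul, h1, h2, one_mul]
  module

theorem memoryOp_apply {h k : Type*} [Fintype h] [Fintype k] [DecidableEq k]
    (U : Matrix (h × k) (h × k) ℂ) (ρ : Matrix h h ℂ) (y y' : k) :
    memoryOp U ρ y y' = ∑ x, ∑ x', U (x, y) (x', y') * ρ x' x := by
  simp [memoryOp, trFirst, Matrix.mul_apply, Fintype.sum_prod_type, Matrix.one_apply]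

theorem memoryOp_permMatrix {k : Type*} [Fintype k] [DecidableEq k]
    (σ : Equiv.Perm (k × k)) (ρ : Matrix k k ℂ) (y y' : k) :
    memoryOp (σ.permMatrix ℂ) ρ y y' =
      ∑ x, if (σ (x, y)).2 = y' then ρ (σ (x, y)).1 x else 0 := by
  rw [memoryOp_apply]
  refine Finset.sum_congr rfl fun x _ => ?_
  simp [Prod.ext_iff, ite_and]

/-- Partial trace over the second tensor factor. -/
def trSecond (M : Matrix (A × B) (A × B) ℂ) : Matrix A A ℂ :=
  Matrix.of fun x x' => ∑ y, M (x, y) (x', y)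

theorem memoryOp_swapFirst (ρ : Matrix (A × B) (A × B) ℂ) :
    memoryOp ((swapFirst A B).permMatrix ℂ) ρ = trSecond ρ ⊗ₖ (1 : Matrix B B ℂ) := by
  ext ⟨c, d⟩ ⟨c', d'⟩
  rw [memoryOp_permMatrix]
  simp [swapFirst, Fintype.sum_prod_type, trSecond, Matrix.one_apply, ite_and]

theorem memoryOp_swapSecond (ρ : Matrix (A × B) (A × B) ℂ) :
    memoryOp ((swapSecond A B).permMatrix ℂ) ρ = (1 : Matrix A A ℂ) ⊗ₖ trFirst ρ := by
  ext ⟨c, d⟩ ⟨c', d'⟩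
  rw [memoryOp_permMatrix]
  simp [swapSecond, Fintype.sum_prod_type, trFirst, Matrix.one_apply, ite_and]

theorem memoryOp_swap (ρ : Matrix (A × B) (A × B) ℂ) :
    memoryOp ((swapFirst A B * swapSecond A B).permMatrix ℂ) ρ = ρ := by
  ext ⟨c, d⟩ ⟨c', d'⟩
  rw [memoryOp_permMatrix]
  simp [swapFirst, swapSecond]

theorem memoryOp_evolution (t : ℝ) {ρ : Matrix (A × B) (A × B) ℂ} (hρ : ρ.trace = 1) :
    memoryOp (evolution (reductionHamiltonian A B) t) ρ =
      (Complex.cos t ^ 2) • (1 : Matrix (A × B) (A × B) ℂ) +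
        (Complex.sin t ^ 2) • (trSecond ρ ⊗ₖ (1 : Matrix B B ℂ)) +
        (Complex.I * Complex.sin t * Complex.cos t) • (ρ - (1 : Matrix A A ℂ) ⊗ₖ trFirst ρ) := by
  have hcos : (Complex.cos (2 * t) - 1) / 4 * 2 = -Complex.sin t ^ 2 := by
    rw [Complex.cos_two_mul]; linear_combination Complex.sin_sq_add_cos_sq (t : ℂ)
  have hsin : -(Complex.I * Complex.sin (2 * t)) / 2 =
      -(Complex.I * Complex.sin t * Complex.cos t) := by
    rw [Complex.sin_two_mul]; ring
  have hcs : Complex.cos t ^ 2 = 1 - Complex.sin t ^ 2 := by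
    linear_combination Complex.sin_sq_add_cos_sq (t : ℂ)
  have hone : memoryOp (1 : Matrix ((A × B) × (A × B)) ((A × B) × (A × B)) ℂ) ρ = 1 := by
    rw [memoryOp, one_mul, trFirst_kronecker, hρ, one_smul]
  rw [evolution_of_cube reductionHamiltonian_cube, reductionHamiltonian_sq, smul_smul, hcos, hsin,
    reductionHamiltonian_eq, hcs, ← hone]
  conv_rhs => rw [← memoryOp_swapFirst, ← memoryOp_swapSecond]
  conv_rhs => enter [2, 2, 1]; rw [← memoryOp_swap ρ]
  simp only [memoryOp, add_mul, sub_mul, smul_mul_assoc, trFirst_add, trFirst_sub, trFirst_smul]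
  module

end Reduction

/-! ### Pure states -/

noncomputable section Pure

variable {ι : Type*} [Fintype ι]

theorem pureDensity_eq_vecMulVec (ψ : EuclideanSpace ℂ ι) :
    pureDensity ψ = Matrix.vecMulVec ψ.ofLp (star ψ.ofLp) := rfl

theorem isHermitian_pureDensity (ψ : EuclideanSpace ℂ ι) : (pureDensity ψ).IsHermitian := by
  ext i j; simp [pureDensity, mul_comm]

theorem dotProduct_star_self {ψ : EuclideanSpace ℂ ι} (hψ : ‖ψ‖ = 1) :
    ψ.ofLp ⬝ᵥ star ψ.ofLp = 1 := by
  rw [← EuclideanSpace.inner_eq_star_dotProduct, inner_self_eq_norm_sq_to_K, hψ]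
  simp

theorem trace_pureDensity {ψ : EuclideanSpace ℂ ι} (hψ : ‖ψ‖ = 1) :
    (pureDensity ψ).trace = 1 := by
  rw [pureDensity_eq_vecMulVec, Matrix.trace_vecMulVec, dotProduct_star_self hψ]

theorem pureDensity_mul_self {ψ : EuclideanSpace ℂ ι} (hψ : ‖ψ‖ = 1) :
    pureDensity ψ * pureDensity ψ = pureDensity ψ := by
  rw [pureDensity_eq_vecMulVec, Matrix.vecMulVec_mul_vecMulVec, dotProduct_comm,
    dotProduct_star_self hψ, one_smul]

theorem trace_mul_pureDensity (M : Matrix ι ι ℂ) (ψ : EuclideanSpace ℂ ι) :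
    (M * pureDensity ψ).trace = (M *ᵥ ψ.ofLp) ⬝ᵥ star ψ.ofLp := by
  rw [pureDensity_eq_vecMulVec, Matrix.mul_vecMulVec, Matrix.trace_vecMulVec]

open scoped Matrix.Norms.L2Operator in
theorem Matrix.l2_opNorm_le_one_of_conjTranspose_mul_self {m n : Type*} [Fintype m] [Fintype n]
    [DecidableEq m] [DecidableEq n] {W : Matrix m n ℂ} (hW : Wᴴ * W = 1) : ‖W‖ ≤ 1 := by
  have h1 : ‖(1 : Matrix n n ℂ)‖ ≤ 1 := by
    rw [← Matrix.permMatrix_one]; exact Matrix.permMatrix_l2_opNorm_le 1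
  rw [← hW, Matrix.l2_opNorm_conjTranspose_mul_self] at h1
  nlinarith [norm_nonneg W]

open scoped Matrix.Norms.L2Operator in
/-- For a unitary `U` and a pure state `ψ` the operator `Tr₁ [U (|ψ⟩⟨ψ| ⊗ 1)] = ⟨ψ| U |ψ⟩` is a
compression of `U`, hence a contraction. -/
theorem norm_memoryOp_le {h k : Type*} [Fintype h] [Fintype k] [DecidableEq h] [DecidableEq k]
    {U : Matrix (h × k) (h × k) ℂ} (hU : Uᴴ * U = 1) {ψ : EuclideanSpace ℂ h} (hψ : ‖ψ‖ = 1) :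
    ‖memoryOp U (pureDensity ψ)‖ ≤ 1 := by
  -- the isometry `x ↦ ψ ⊗ x`
  set W : Matrix (h × k) k ℂ := Matrix.of fun p y => if p.2 = y then ψ p.1 else 0 with hWdef
  have hW : Wᴴ * W = 1 := by
    ext y y'
    have := dotProduct_star_self hψ
    simp only [dotProduct, Pi.star_apply] at this
    rcases eq_or_ne y y' with rfl | hy
    · simpa [hWdef, Matrix.mul_apply, Fintype.sum_prod_type, apply_ite (starRingEnd ℂ),
        mul_comm] using this
    · simp [hWdef, Matrix.mul_apply, Fintype.sum_prod_type, apply_ite (starRingEnd ℂ), hy, hy.symm]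
  have hL : memoryOp U (pureDensity ψ) = Wᴴ * (U * W) := by
    ext y y'
    rw [memoryOp_apply]
    simp [hWdef, Matrix.mul_apply, Fintype.sum_prod_type, pureDensity,
      apply_ite (starRingEnd ℂ), Finset.mul_sum]
    refine Finset.sum_congr rfl fun x _ => Finset.sum_congr rfl fun x' _ => ?_
    ring
  rw [hL]
  have hW1 := Matrix.l2_opNorm_le_one_of_conjTranspose_mul_self hW
  have hU1 := Matrix.l2_opNorm_le_one_of_conjTranspose_mul_self hU
  calc ‖Wᴴ * (U * W)‖ ≤ ‖Wᴴ‖ * (‖U‖ * ‖W‖) :=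
        (Matrix.l2_opNorm_mul _ _).trans (by gcongr; exact Matrix.l2_opNorm_mul _ _)
    _ ≤ 1 * (1 * 1) := by rw [Matrix.l2_opNorm_conjTranspose]; gcongr
    _ = 1 := by norm_num

/-- Iterating a contraction on an approximate eigenvector accumulates the error at most
linearly. -/
theorem norm_pow_apply_sub_le {E : Type*} [NormedAddCommGroup E] [NormedSpace ℂ E]
    {T : E →L[ℂ] E} (hT : ‖T‖ ≤ 1) {μ : ℂ} (hμ : ‖μ‖ ≤ 1) (v : E) (K : ℕ) :
    ‖(T ^ K) v - μ ^ K • v‖ ≤ K * ‖T v - μ • v‖ := by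
  induction K with
  | zero => simp
  | succ K ih =>
    have hsplit : (T ^ (K + 1)) v - μ ^ (K + 1) • v =
        T ((T ^ K) v - μ ^ K • v) + μ ^ K • (T v - μ • v) := by
      rw [pow_succ', mul_apply_eq_comp, map_sub, map_smul, smul_sub, smul_smul,
        pow_succ]
      abel
    have h1 : ‖T ((T ^ K) v - μ ^ K • v)‖ ≤ K * ‖T v - μ • v‖ :=
      ((T.le_of_opNorm_le hT _).trans (one_mul _).le).trans ih
    have h2 : ‖μ ^ K • (T v - μ • v)‖ ≤ ‖T v - μ • v‖ := by
      rw [norm_smul, norm_pow]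
      exact mul_le_of_le_one_left (norm_nonneg _) (pow_le_one₀ (norm_nonneg _) hμ)
    rw [hsplit]
    exact (norm_add_le_of_le h1 h2).trans_eq (by push_cast; ring)

end Pure

/-! ### The circuit on product states and on generic pure states -/

noncomputable section SinglePure

variable {A B : Type*} [Fintype A] [Fintype B]

theorem trSecond_kronecker_mulVec [DecidableEq B] (ψ : EuclideanSpace ℂ (A × B)) (a : A) (b : B) :
    ((trSecond (pureDensity ψ) ⊗ₖ (1 : Matrix B B ℂ)) *ᵥ ψ.ofLp) (a, b) =
      (coeffMatrix ψ * (coeffMatrix ψ)ᴴ * coeffMatrix ψ) a b := by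
  simp [Matrix.mulVec, dotProduct, Fintype.sum_prod_type, Matrix.one_apply, trSecond, pureDensity,
    Matrix.mul_apply, coeffMatrix]

theorem kronecker_trFirst_mulVec [DecidableEq A] (ψ : EuclideanSpace ℂ (A × B)) (a : A) (b : B) :
    (((1 : Matrix A A ℂ) ⊗ₖ trFirst (pureDensity ψ)) *ᵥ ψ.ofLp) (a, b) =
      (coeffMatrix ψ * (coeffMatrix ψ)ᴴ * coeffMatrix ψ) a b := by
  simp only [Matrix.mul_assoc, Matrix.mul_apply (M := coeffMatrix ψ)]
  simp [Matrix.mulVec, dotProduct, Fintype.sum_prod_type, Matrix.one_apply, trFirst, pureDensity,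
    Matrix.mul_apply, coeffMatrix, Finset.mul_sum, Finset.sum_mul]
  refine Finset.sum_congr rfl fun x _ => Finset.sum_congr rfl fun x' _ => ?_
  ring

attribute [local instance] Matrix.frobeniusNormedAddCommGroup in
theorem Matrix.sum_norm_sq_eq_frobenius_norm_sq {m n : Type*} [Fintype m] [Fintype n]
    (W : Matrix m n ℂ) : ∑ i, ∑ j, ‖W i j‖ ^ 2 = ‖W‖ ^ 2 := by
  have h0 : (0 : ℝ) ≤ ∑ i, ∑ j, ‖W i j‖ ^ 2 :=
    Finset.sum_nonneg fun _ _ => Finset.sum_nonneg fun _ _ => by positivity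
  rw [Matrix.frobenius_norm_def, ← Real.sqrt_eq_rpow]
  simp only [Real.rpow_two]
  rw [Real.sq_sqrt h0]

attribute [local instance] Matrix.frobeniusNormedAddCommGroup in
/-- `‖M Mᴴ M‖ ≤ ‖M Mᴴ‖ ‖M‖` in the Frobenius norm, where `M` is the coefficient matrix of `ψ`. -/
theorem sum_norm_sq_coeffMatrix_le {ψ : EuclideanSpace ℂ (A × B)} (hψ : ‖ψ‖ = 1) :
    ∑ a, ∑ b, ‖(coeffMatrix ψ * (coeffMatrix ψ)ᴴ * coeffMatrix ψ) a b‖ ^ 2 ≤ purity ψ := by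
  have hM : ‖coeffMatrix ψ‖ ^ 2 = 1 := by
    have h := EuclideanSpace.norm_sq_eq ψ
    rw [hψ, Fintype.sum_prod_type, one_pow] at h
    rw [← Matrix.sum_norm_sq_eq_frobenius_norm_sq, h]
    rfl
  rw [purity, Matrix.sum_norm_sq_eq_frobenius_norm_sq, Matrix.sum_norm_sq_eq_frobenius_norm_sq]
  calc ‖coeffMatrix ψ * (coeffMatrix ψ)ᴴ * coeffMatrix ψ‖ ^ 2 ≤
        (‖coeffMatrix ψ * (coeffMatrix ψ)ᴴ‖ * ‖coeffMatrix ψ‖) ^ 2 := by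
          gcongr
          exact Matrix.frobenius_norm_mul _ _
    _ = ‖coeffMatrix ψ * (coeffMatrix ψ)ᴴ‖ ^ 2 := by rw [mul_pow, hM, mul_one]

variable [DecidableEq A] [DecidableEq B]

/-- On a product of pure states the circuit never leaves the state `|+⟩ ⊗ ρ`: the operator
`memoryOp` fixes `ρ`, and the outcome is `0` with certainty. -/
theorem outcomeProb_product (t : ℝ) (K : ℕ) {φ : EuclideanSpace ℂ A} {χ : EuclideanSpace ℂ B}
    (hφ : ‖φ‖ = 1) (hχ : ‖χ‖ = 1) :
    outcomeProb (reductionHamiltonian A B) t K (pureDensity φ ⊗ₖ pureDensity χ) 0 = 1 := by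
  set ρ := pureDensity φ ⊗ₖ pureDensity χ with hρ
  have htr : ρ.trace = 1 := by
    rw [hρ, Matrix.trace_kronecker, trace_pureDensity hφ, trace_pureDensity hχ, one_mul]
  have hherm : ρ.IsHermitian := by
    rw [hρ, Matrix.IsHermitian, Matrix.conjTranspose_kronecker,
      (isHermitian_pureDensity φ).eq, (isHermitian_pureDensity χ).eq]
  have hfirst : trFirst ρ = pureDensity χ := by
    rw [hρ, trFirst_kronecker, trace_pureDensity hφ, one_smul]
  have hsecond : trSecond ρ = pureDensity φ := by
    have h := trace_pureDensity hχ
    ext a a'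
    simp only [Matrix.trace, Matrix.diag_apply] at h
    simp [hρ, trSecond, ← Finset.mul_sum, h]
  have hfix : ∀ s : ℝ, memoryOp (evolution (reductionHamiltonian A B) s) ρ * ρ = ρ := by
    intro s
    have hcs : Complex.cos s ^ 2 = 1 - Complex.sin s ^ 2 := by
      linear_combination Complex.sin_sq_add_cos_sq (s : ℂ)
    rw [memoryOp_evolution s htr, hfirst, hsecond, hρ, hcs]
    simp only [add_mul, sub_mul, smul_mul_assoc, one_mul, ← Matrix.mul_kronecker_mul,
      pureDensity_mul_self hφ, pureDensity_mul_self hχ]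
    module
  have hpow : memoryOp (evolution (reductionHamiltonian A B) (t / K)) ρ ^ K * ρ = ρ := by
    have hiter : ∀ j : ℕ,
        memoryOp (evolution (reductionHamiltonian A B) (t / K)) ρ ^ j * ρ = ρ := fun j => by
      induction j with
      | zero => rw [pow_zero, one_mul]
      | succ j ih => rw [pow_succ, mul_assoc, hfix, ih]
    exact hiter K
  rw [outcomeProb_eq isHermitian_reductionHamiltonian reductionHamiltonian_cube t K hherm htr,
    hpow, htr]
  norm_num

/-- A normalized pure state is an eigenvector of its `memoryOp` with eigenvalue `e^{it} cos t`, up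
to an error controlled by the purity of its reduced states. -/
theorem norm_memoryOp_apply_sub_le (t : ℝ) {ψ : EuclideanSpace ℂ (A × B)} (hψ : ‖ψ‖ = 1) :
    ‖Matrix.toEuclideanCLM (𝕜 := ℂ)
        (memoryOp (evolution (reductionHamiltonian A B) t) (pureDensity ψ)) ψ -
      (Complex.cos t * Complex.exp (t * Complex.I)) • ψ‖ ≤ |Real.sin t| * √(purity ψ) := by
  set v : EuclideanSpace ℂ (A × B) := WithLp.toLp 2 fun p =>
    (coeffMatrix ψ * (coeffMatrix ψ)ᴴ * coeffMatrix ψ) p.1 p.2 with hv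
  have hnorm : ‖v‖ ≤ √(purity ψ) := by
    rw [EuclideanSpace.norm_eq, Fintype.sum_prod_type]
    exact Real.sqrt_le_sqrt (sum_norm_sq_coeffMatrix_le hψ)
  have hself : pureDensity ψ *ᵥ ψ.ofLp = ψ.ofLp := by
    rw [pureDensity_eq_vecMulVec, Matrix.vecMulVec_mulVec, dotProduct_comm,
      dotProduct_star_self hψ]
    simp
  have hdiff : Matrix.toEuclideanCLM (𝕜 := ℂ)
        (memoryOp (evolution (reductionHamiltonian A B) t) (pureDensity ψ)) ψ -
      (Complex.cos t * Complex.exp (t * Complex.I)) • ψ =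
      (-Complex.I * Complex.sin t * Complex.exp (t * Complex.I)) • v := by
    ext ⟨a, b⟩
    rw [memoryOp_evolution t (trace_pureDensity hψ), Complex.exp_mul_I]
    simp only [PiLp.sub_apply, PiLp.smul_apply, Matrix.ofLp_toEuclideanCLM, Matrix.add_mulVec,
      Matrix.sub_mulVec, Matrix.smul_mulVec, Matrix.one_mulVec, hself, Pi.add_apply, Pi.sub_apply,
      Pi.smul_apply, trSecond_kronecker_mulVec, kronecker_trFirst_mulVec, smul_eq_mul, hv]
    linear_combination (Complex.sin t ^ 2 *
      (coeffMatrix ψ * (coeffMatrix ψ)ᴴ * coeffMatrix ψ) a b) * Complex.I_sq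
  rw [hdiff, norm_smul]
  refine mul_le_mul (le_of_eq ?_) hnorm (norm_nonneg _) (abs_nonneg _)
  rw [norm_mul, norm_mul, norm_neg, Complex.norm_I, Complex.norm_exp_ofReal_mul_I,
    ← Complex.ofReal_sin, Complex.norm_real, one_mul, mul_one, Real.norm_eq_abs]

theorem re_trace_memoryOp_pow_le {K : ℕ} (hK : 2 ≤ K) {ψ : EuclideanSpace ℂ (A × B)}
    (hψ : ‖ψ‖ = 1) :
    (memoryOp (evolution (reductionHamiltonian A B) (Real.pi / K)) (pureDensity ψ) ^ K *
      pureDensity ψ).trace.re ≤ Real.pi * √(purity ψ) := by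
  have hK0 : (0 : ℝ) < K := by exact_mod_cast (by omega : 0 < K)
  have hK2 : (2 : ℝ) ≤ K := by exact_mod_cast hK
  set t : ℝ := Real.pi / K with ht
  have htpos : 0 ≤ t := by positivity
  have htK : K * t = Real.pi := by rw [ht]; field_simp
  set L := memoryOp (evolution (reductionHamiltonian A B) t) (pureDensity ψ)
  set T := Matrix.toEuclideanCLM (𝕜 := ℂ) L with hT
  set μ : ℂ := Complex.cos t * Complex.exp (t * Complex.I) with hμ
  have hTnorm : ‖T‖ ≤ 1 :=
    norm_memoryOp_le (conjTranspose_evolution_mul_self isHermitian_reductionHamiltonian t) hψ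
  have hμnorm : ‖μ‖ ≤ 1 := by
    rw [hμ, norm_mul, Complex.norm_exp_ofReal_mul_I, mul_one, ← Complex.ofReal_cos,
      Complex.norm_real]
    exact Real.abs_cos_le_one t
  have hclose := (norm_pow_apply_sub_le hTnorm hμnorm ψ K).trans
    (mul_le_mul_of_nonneg_left (norm_memoryOp_apply_sub_le t hψ) hK0.le)
  have htrace : (L ^ K * pureDensity ψ).trace = inner ℂ ψ ((T ^ K) ψ) := by
    rw [trace_mul_pureDensity, EuclideanSpace.inner_eq_star_dotProduct, hT, ← map_pow,
      Matrix.ofLp_toEuclideanCLM]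
  have hsplit : (L ^ K * pureDensity ψ).trace = inner ℂ ψ ((T ^ K) ψ - μ ^ K • ψ) + μ ^ K := by
    rw [htrace, inner_sub_right, inner_smul_right, inner_self_eq_norm_sq_to_K, hψ]
    simp
  -- the phases of the `K` steps multiply to `e^{iπ} = -1`
  have hμK : μ ^ K = ((-(Real.cos t) ^ K : ℝ) : ℂ) := by
    have hphase : (K : ℂ) * (t * Complex.I) = Real.pi * Complex.I := by
      rw [← htK]; push_cast; ring
    rw [hμ, mul_pow, ← Complex.exp_nat_mul, hphase, Complex.exp_pi_mul_I]
    push_cast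
    ring
  have hcos : 0 ≤ Real.cos t := by
    refine Real.cos_nonneg_of_mem_Icc ⟨by linarith [Real.pi_pos], ?_⟩
    rw [ht]
    exact div_le_div_of_nonneg_left Real.pi_pos.le two_pos hK2
  have hsin : |Real.sin t| ≤ t := by
    simpa [abs_of_nonneg htpos] using Real.abs_sin_le_abs (x := t)
  have hinner : (inner ℂ ψ ((T ^ K) ψ - μ ^ K • ψ)).re ≤ Real.pi * √(purity ψ) := by
    calc (inner ℂ ψ ((T ^ K) ψ - μ ^ K • ψ)).re ≤ ‖inner ℂ ψ ((T ^ K) ψ - μ ^ K • ψ)‖ :=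
          Complex.re_le_norm _
      _ ≤ ‖ψ‖ * ‖(T ^ K) ψ - μ ^ K • ψ‖ := norm_inner_le_norm _ _
      _ ≤ K * (|Real.sin t| * √(purity ψ)) := by rw [hψ, one_mul]; exact hclose
      _ ≤ K * (t * √(purity ψ)) := by gcongr
      _ = Real.pi * √(purity ψ) := by rw [← mul_assoc, htK]
  have hμre : (μ ^ K).re ≤ 0 := by
    rw [hμK, Complex.ofReal_re]
    linarith [pow_nonneg hcos K]
  rw [hsplit, Complex.add_re]
  linarith

/-- The restriction `2 ≤ K` is needed: for `K = 1` the evolution over time `π` is the identity, and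
the outcome is always `0`. -/
theorem le_outcomeProb_pure {K : ℕ} (hK : 2 ≤ K) {ψ : EuclideanSpace ℂ (A × B)} (hψ : ‖ψ‖ = 1) :
    1 / 2 - Real.pi / 2 * (1 / 20 + 5 * purity ψ) ≤
      outcomeProb (reductionHamiltonian A B) Real.pi K (pureDensity ψ) 1 := by
  rw [outcomeProb_eq isHermitian_reductionHamiltonian reductionHamiltonian_cube _ _
    (isHermitian_pureDensity ψ) (trace_pureDensity hψ)]
  have h := re_trace_memoryOp_pow_le hK hψ
  -- a form of AM-GM that avoids averaging a square root; its constants serve the final estimate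
  have hsqrt : √(purity ψ) ≤ 1 / 20 + 5 * purity ψ := by
    nlinarith [Real.sq_sqrt (purity_nonneg ψ), sq_nonneg (10 * √(purity ψ) - 1)]
  have := mul_le_mul_of_nonneg_left hsqrt Real.pi_pos.le
  simp only [Fin.val_one, pow_one]
  linarith

end SinglePure

/-! ### Averaging over the ensemble -/

noncomputable section Average

open MeasureTheory Metric

theorem integral_outcomeProb_product (n K : ℕ) (hn : 0 < n) :
    ∫ ψ, outcomeProb (reductionHamiltonian (Fin n) (Fin n)) Real.pi K
      (pureDensity (ψ.1 : EuclideanSpace ℂ (Fin n)) ⊗ₖ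
        pureDensity (ψ.2 : EuclideanSpace ℂ (Fin n))) 0
      ∂((haarState (Fin n)).prod (haarState (Fin n))) = 1 := by
  have : Nonempty (Fin n) := ⟨⟨0, hn⟩⟩
  have h : ∀ ψ : sphere (0 : EuclideanSpace ℂ (Fin n)) 1 × sphere (0 : EuclideanSpace ℂ (Fin n)) 1,
      outcomeProb (reductionHamiltonian (Fin n) (Fin n)) Real.pi K
        (pureDensity (ψ.1 : EuclideanSpace ℂ (Fin n)) ⊗ₖ
          pureDensity (ψ.2 : EuclideanSpace ℂ (Fin n))) 0 = 1 :=
    fun ψ => outcomeProb_product _ _ (by simp) (by simp)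
  simp [h]

theorem continuous_outcomeProb_pure {k : Type*} [Fintype k] [DecidableEq k]
    {H : Matrix (k × k) (k × k) ℂ} (hH : H.IsHermitian) (hH3 : H * H * H = (4 : ℂ) • H) (t : ℝ)
    (K : ℕ) (b : Fin 2) :
    Continuous fun ψ : sphere (0 : EuclideanSpace ℂ k) 1 =>
      outcomeProb H t K (pureDensity (ψ : EuclideanSpace ℂ k)) b := by
  have h : ∀ ψ : sphere (0 : EuclideanSpace ℂ k) 1, _ := fun ψ =>
    outcomeProb_eq hH hH3 t K (isHermitian_pureDensity ψ.1) (trace_pureDensity (by simp)) b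
  simp only [h]
  have hρ : Continuous fun ψ : sphere (0 : EuclideanSpace ℂ k) 1 => pureDensity ψ.1 :=
    continuous_matrix fun i j => by
      simp only [pureDensity, Matrix.of_apply]
      fun_prop
  have hL : Continuous fun ψ : sphere (0 : EuclideanSpace ℂ k) 1 =>
      memoryOp (evolution H (t / K)) (pureDensity ψ.1) :=
    continuous_matrix fun i j => by
      simp only [memoryOp_apply, pureDensity, Matrix.of_apply]
      fun_prop
  exact continuous_const.add (continuous_const.mul
    ((Complex.continuous_re.comp ((hL.pow K).matrix_mul hρ).matrix_trace).div_const 2))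

theorem one_third_le_integral_outcomeProb_pure {n K : ℕ} (hn : 1000 ≤ n) (hK : 2 ≤ K) :
    1 / 3 ≤ ∫ ψ, outcomeProb (reductionHamiltonian (Fin n) (Fin n)) Real.pi K
      (pureDensity (ψ : EuclideanSpace ℂ (Fin n × Fin n))) 1 ∂(haarState (Fin n × Fin n)) := by
  have : Nonempty (Fin n) := ⟨⟨0, by omega⟩⟩
  have hnR : (1000 : ℝ) ≤ n := by exact_mod_cast hn
  have hpint : Integrable (fun ψ : sphere (0 : EuclideanSpace ℂ (Fin n × Fin n)) 1 => purity ψ.1)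
      (haarState (Fin n × Fin n)) :=
    integrable_haarState (continuous_purity.comp continuous_subtype_val)
  have hmono := integral_mono (μ := haarState (Fin n × Fin n))
    (f := fun ψ => 1 / 2 - Real.pi / 2 * (1 / 20 + 5 * purity ψ.1))
    ((integrable_const _).sub (((integrable_const _).add (hpint.const_mul 5)).const_mul _))
    (integrable_haarState (continuous_outcomeProb_pure isHermitian_reductionHamiltonian
      reductionHamiltonian_cube Real.pi K 1))
    (fun ψ => le_outcomeProb_pure hK (by simp))
  have hlhs : ∫ ψ : sphere (0 : EuclideanSpace ℂ (Fin n × Fin n)) 1,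
      (1 / 2 - Real.pi / 2 * (1 / 20 + 5 * purity ψ.1)) ∂haarState (Fin n × Fin n) =
      1 / 2 - Real.pi / 2 * (1 / 20 + 5 * ∫ ψ, purity ψ.1 ∂haarState (Fin n × Fin n)) := by
    rw [integral_sub (integrable_const _)
      (((integrable_const _).fun_add (hpint.const_mul 5)).const_mul _), integral_const_mul,
      integral_add (integrable_const _) (hpint.const_mul 5), integral_const_mul]
    simp
  have hpurity : ∫ ψ, purity ψ.1 ∂haarState (Fin n × Fin n) ≤ 1 / 100 := by
    refine (integral_purity_le ?_).trans ?_
    · rw [Fintype.card_prod, Fintype.card_fin]; nlinarith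
    · rw [Fintype.card_fin, div_le_iff₀ (by nlinarith)]
      nlinarith
  refine le_trans ?_ (hlhs ▸ hmono)
  nlinarith [Real.pi_lt_d2, Real.pi_pos]

end Average

theorem theorem5 :
    (∀ dA dB : ℕ, hmeHamiltonian (partialReduction (Fin dA) (Fin dB)) =
      reductionHamiltonian (Fin dA) (Fin dB)) ∧
    ∃ C N : ℕ, ∀ n : ℕ, N ≤ n → ∀ K : ℕ, C ≤ K + 1 → 2 / 3 ≤ successProb n K := by
  refine ⟨fun _ _ => hmeHamiltonian_partialReduction, 3, 1000, fun n hn K hK => ?_⟩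
  have h := one_third_le_integral_outcomeProb_pure hn (show 2 ≤ K by omega)
  rw [successProb, integral_outcomeProb_product n K (by omega)]
  linarith
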